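/- Let $\sigma_1,\sigma_2,\sigma_3$ be the Pauli matrices, $\alpha_j=\begin{pmatrix}0&\sigma_j\\ \sigma_j&0\end{pmatrix}$ ($j=1,2,3$) the Dirac matrices, and $\alpha\cdot p=-i\sum_{j=1}^3\alpha_j\partial_j$ on $\mathbb{R}^3$. For $r>0$ put $B_r^c=\{x\in\mathbb{R}^3:|x|\ge r\}$. Let $Q$ be a measurable $4\times4$ complex-matrix-valued function with $Q(x)=O(|x|^{-1})$ in $B_1^c$, that is, $|q_{jk}(x)|\le C|x|^{-1}$ for some constant $C$, all $j,k$ and almost every $x$ with $|x|\ge1$. Let $\psi\in (L^2(B_1^c))^4$ be a weak solution of $(\alpha\cdot p)\psi=-Q\psi$ in $\{|x|>1\}$, that is, $$\int_{|x|>1}\bigl(\langle\psi,(\alpha\cdot p)f\rangle+\langle Q\psi,f\rangle\bigr)\,dx=0\qquad\text{for all } f\in (C_0^\infty(\{|x|>1\}))^4,$$ where $\langle z,w\rangle=\sum_{j=1}^4z_j\overline{w_j}$. Then $\psi(x)=|x|^{-2}\phi(x)$ in $B_1^c$, where for every $k\in[1,10/3)$ $$\int_{|x|\ge R}|\phi(x)|^k|x|^{-6}\,dx<\infty\qquad\text{for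 every } R>1 .$$ Moreover $$\int_{B_1^c}|\phi(x)|^k|x|^{-6}\,dx<\infty$$ if $k\le 2$, and also, for every $k\in[1,10/3)$, if the hypotheses hold slightly beyond the unit sphere, that is, if for some $r\in(0,1)$ one has $\psi\in(L^2(B_r^c))^4$, $Q$ is measurable and $O(|x|^{-1})$ in $B_r^c$, and $\psi$ is a weak solution of $(\alpha\cdot p)\psi=-Q\psi$ in $\{|x|>r\}$. -/

import Mathlib

open MeasureTheory
open scoped ContDiff Matrix

/-- Physical space `ℝ³` with the Euclidean norm. -/
abbrev Space3 : Type := EuclideanSpace ℝ (Fin 3)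

/-- Four-component spinors: `ℂ⁴` with the Hermitian norm. -/
abbrev Spinor : Type := EuclideanSpace ℂ (Fin 4)

noncomputable section

/-- The Pauli matrices `σ₁, σ₂, σ₃`. -/
def pauli : Fin 3 → Matrix (Fin 2) (Fin 2) ℂ :=
  ![!![0, 1; 1, 0], !![0, -Complex.I; Complex.I, 0], !![1, 0; 0, -1]]

/-- The Dirac matrices `α_j`, with zero diagonal blocks and off-diagonal blocks `σ_j`. -/
def diracAlpha (j : Fin 3) : Matrix (Fin 4) (Fin 4) ℂ :=
  Matrix.reindex finSumFinEquiv finSumFinEquiv (Matrix.fromBlocks 0 (pauli j) (pauli j) 0)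

/-- The action of a `4 × 4` matrix on a spinor. -/
def matAct (A : Matrix (Fin 4) (Fin 4) ℂ) (z : Spinor) : Spinor :=
  WithLp.toLp 2 (A *ᵥ z.ofLp)

/-- `(α · p) f = ∑ j, α_j (-i ∂_j f)`, for (classically) differentiable `f`. -/
def alphaDotP (f : Space3 → Spinor) (x : Space3) : Spinor :=
  ∑ j : Fin 3, matAct (diracAlpha j)
    (-Complex.I • fderiv ℝ f x (EuclideanSpace.single j (1 : ℝ)))

/-- The pairing `⟨z, w⟩ = ∑ j, z_j * conj w_j`, linear in the first argument. -/
def spinorPair (z w : Spinor) : ℂ := ∑ j : Fin 4, z j * (starRingEnd ℂ) (w j)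

/-- `f ∈ (C₀^∞(Ω))⁴`. -/
structure IsTestSpinor (Ω : Set Space3) (f : Space3 → Spinor) : Prop where
  smooth : ContDiff ℝ ∞ f
  compact_support : HasCompactSupport f
  support_subset : tsupport f ⊆ Ω

/-- `(α · p) ψ = -Q ψ` in the open set `Ω`, in the weak sense. Since `α · p` is formally
self-adjoint, this says `∫_Ω ⟨ψ, (α · p) f⟩ + ⟨Q ψ, f⟩ = 0` for all test spinors `f`. -/
def IsWeakDiracSolution (Ω : Set Space3) (Q : Space3 → Matrix (Fin 4) (Fin 4) ℂ)
    (ψ : Space3 → Spinor) : Prop :=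
  ∀ f : Space3 → Spinor, IsTestSpinor Ω f →
    ∫ x in Ω, (spinorPair (ψ x) (alphaDotP f x) + spinorPair (matAct (Q x) (ψ x)) (f x)) = 0

/-- The complement of the open ball of radius `r` about the origin. -/
def ballCompl (r : ℝ) : Set Space3 := {x | r ≤ ‖x‖}

/-- `ψ` is a square-integrable weak solution of `(α · p) ψ = -Q ψ` outside the ball of radius `r`,
where the (measurable) potential `Q` is `O(|x|⁻¹)` there. -/
structure IsL2ExteriorSolution (r : ℝ) (Q : Space3 → Matrix (Fin 4) (Fin 4) ℂ)
    (ψ : Space3 → Spinor) : Prop where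
  potential_measurable : ∀ i j : Fin 4,
    AEStronglyMeasurable (fun x => Q x i j) (volume.restrict (ballCompl r))
  potential_bound : ∃ C : ℝ, ∀ᵐ x ∂(volume.restrict (ballCompl r)),
    ∀ i j : Fin 4, ‖Q x i j‖ ≤ C * ‖x‖⁻¹
  memLp_two : MemLp ψ 2 (volume.restrict (ballCompl r))
  weak_solution : IsWeakDiracSolution {x | r < ‖x‖} Q ψ

end

/-! Take φ = |x|²ψ. Then |φ|⁶|x|⁻⁶ = (|x||ψ|)⁶, and |x|⁻⁶ dx is a finite measure on B₁ᶜ, so |x|ψ ∈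
L⁶ gives every moment with 0 ≤ k ≤ 6; the range k < 10/3 lies well inside.

The L⁶ bound comes from applying the Dirac operator to x_i ψ. The result is iα_i ψ + x_i Qψ, and
both terms are in L² because Q = O(|x|⁻¹). Since the α_j anticommute and square to 1, ‖(α·p)v‖₂ =
‖∇v‖₂ (`integral_norm_sq_diracOp`), so Sobolev's inequality bounds ‖v‖₆ by ‖(α·p)v‖₂. Mollification
extends this to weak solutions (`exists_eLpNorm_six_le_of_isWeakDiracOp`). Cut-offs of x_i, with
bounds uniform in the truncation (`exists_coordinate_cutoff`), and Fatou's lemma then give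
`integrableOn_norm_mul_pow_six`.

The cut-offs must vanish near the inner sphere, hence R > r. Up to |x| = 1, either the hypotheses
hold for some r < 1, or k ≤ 2 and ψ ∈ L² already suffices. -/

noncomputable section

open scoped ENNReal NNReal Topology Convolution
open Filter

/-! ### Algebra of the Dirac matrices -/

/-- The skew-adjoint matrices `i α_j`, as real-linear maps. -/
def iAlpha (j : Fin 3) : Spinor →L[ℝ] Spinor :=
  (Matrix.toEuclideanCLM (n := Fin 4) (𝕜 := ℂ) (Complex.I • diracAlpha j)).restrictScalars ℝ

/-- The `j`-th standard basis vector of `ℝ³`. -/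
abbrev stdVec (j : Fin 3) : Space3 := EuclideanSpace.single j (1 : ℝ)

lemma iAlpha_apply (j : Fin 3) (z : Spinor) (k : Fin 4) :
    iAlpha j z k = ∑ l, Complex.I * diracAlpha j k l * z l := by
  simp [iAlpha, Matrix.ofLp_toEuclideanCLM, Matrix.mulVec, dotProduct, mul_assoc, Finset.mul_sum]

lemma diracAlpha_eq : diracAlpha =
    ![!![0, 0, 0, 1; 0, 0, 1, 0; 0, 1, 0, 0; 1, 0, 0, 0],
      !![0, 0, 0, -Complex.I; 0, 0, Complex.I, 0; 0, -Complex.I, 0, 0; Complex.I, 0, 0, 0],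
      !![0, 0, 1, 0; 0, 0, 0, -1; 1, 0, 0, 0; 0, -1, 0, 0]] := by
  funext j
  ext a b
  fin_cases j <;> fin_cases a <;> fin_cases b <;> rfl

lemma spinor_inner_eq (a b : Spinor) :
    inner ℝ a b = ∑ k, ((a k).re * (b k).re + (a k).im * (b k).im) := by
  simp [PiLp.inner_apply, Complex.inner, mul_comm]

lemma inner_iAlpha_self (j : Fin 3) (a b : Spinor) :
    inner ℝ (iAlpha j a) (iAlpha j b) = inner ℝ a b := by
  simp only [spinor_inner_eq, iAlpha_apply, diracAlpha_eq]
  fin_cases j <;> simp [Fin.sum_univ_four] <;> ring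

/-- This is anticommutation of distinct skew-adjoint matrices, moved across the inner product. -/
lemma inner_iAlpha_anticomm {j k : Fin 3} (hjk : j ≠ k) (a b : Spinor) :
    inner ℝ (iAlpha j a) (iAlpha k b) = -inner ℝ (iAlpha k a) (iAlpha j b) := by
  simp only [spinor_inner_eq, iAlpha_apply, diracAlpha_eq]
  fin_cases j <;> fin_cases k <;> first | exact absurd rfl hjk | skip
  all_goals simp [Fin.sum_univ_four]
  all_goals ring

lemma norm_iAlpha (j : Fin 3) (a : Spinor) : ‖iAlpha j a‖ = ‖a‖ := by
  rw [← sq_eq_sq₀ (norm_nonneg _) (norm_nonneg _), ← real_inner_self_eq_norm_sq,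
    ← real_inner_self_eq_norm_sq, inner_iAlpha_self]

/-! ### The L² identity between Dirac operator and gradient -/

section PartialDerivatives

variable {E F : Type*} [NormedAddCommGroup E] [NormedSpace ℝ E] [NormedAddCommGroup F]
  [NormedSpace ℝ F] {v : E → F}

lemma ContDiff.fderiv_apply_const (hv : ContDiff ℝ ∞ v) (e : E) :
    ContDiff ℝ ∞ (fun x => fderiv ℝ v x e) :=
  (hv.fderiv_right (m := ∞) (by simp)).clm_apply contDiff_const

variable [MeasurableSpace E] [BorelSpace E] [FiniteDimensional ℝ E] {μ : Measure E}
  [μ.IsAddHaarMeasure]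

/-- Integrating by parts twice exchanges the directions of differentiation. -/
lemma integral_bilinear_fderiv_swap (hv : ContDiff ℝ ∞ v) (hc : HasCompactSupport v)
    (B : F →L[ℝ] F →L[ℝ] ℝ) (e e' : E) :
    ∫ x, B (fderiv ℝ v x e) (fderiv ℝ v x e') ∂μ =
      ∫ x, B (fderiv ℝ v x e') (fderiv ℝ v x e) ∂μ := by
  -- Moving the derivative off the second factor leaves the Hessian, which is symmetric in the two
  -- directions.
  have key : ∀ a b : E, ∫ x, B (fderiv ℝ v x a) (fderiv ℝ v x b) ∂μ =
      -∫ x, B (fderiv ℝ (fderiv ℝ v) x b a) (v x) ∂μ := by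
    intro a b
    have h1 : ContDiff ℝ ∞ (fun x => fderiv ℝ v x a) := hv.fderiv_apply_const a
    have h2 : ContDiff ℝ ∞ (fun x => fderiv ℝ v x b) := hv.fderiv_apply_const b
    have h3 : ContDiff ℝ ∞ (fun x => fderiv ℝ (fun y => fderiv ℝ v y a) x b) :=
      h1.fderiv_apply_const b
    have hcd : HasCompactSupport (fun x => fderiv ℝ v x b) := hc.fderiv_apply (𝕜 := ℝ) b
    have e1 : ∀ x, fderiv ℝ (fun y => fderiv ℝ v y a) x b = fderiv ℝ (fderiv ℝ v) x b a := by
      intro x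
      have hd : DifferentiableAt ℝ (fderiv ℝ v) x :=
        ((hv.fderiv_right (m := ∞) (by simp)).differentiable (by simp)) x
      rw [fderiv_clm_apply hd (differentiableAt_const a)]
      simp
    simp only [← e1]
    have cB : ∀ {f g : E → F}, Continuous f → Continuous g → Continuous fun x => B (f x) (g x) :=
      fun hf hg => (B.continuous.comp hf).clm_apply hg
    have sB : ∀ {f g : E → F}, HasCompactSupport g → HasCompactSupport fun x => B (f x) (g x) := by
      intro f g hg
      refine hg.mono fun x hx => ?_
      contrapose! hx
      simp only [Function.mem_support, not_not] at hx ⊢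
      simp [hx]
    refine integral_bilinear_fderiv_right_eq_neg_left_of_integrable
      (f := fun y => fderiv ℝ v y a) (g := v) (v := b) (B := B) ?_ ?_ ?_
      (fun x _ => h1.differentiable (by simp) x) (fun x _ => hv.differentiable (by simp) x)
    · exact (cB h3.continuous hv.continuous).integrable_of_hasCompactSupport (sB hc)
    · exact (cB h1.continuous h2.continuous).integrable_of_hasCompactSupport (sB hcd)
    · exact (cB h1.continuous hv.continuous).integrable_of_hasCompactSupport (sB hc)
  rw [key e e', key e' e]
  congr 2
  funext x
  have : IsSymmSndFDerivAt ℝ v x := (hv.contDiffAt).isSymmSndFDerivAt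
    (by simpa using WithTop.coe_le_coe.2 (le_top : (2 : ℕ∞) ≤ ⊤))
  rw [this.eq]

end PartialDerivatives

/-- The first-order operator `∑ j, i α_j ∂_j`. -/
def diracOp (v : Space3 → Spinor) (x : Space3) : Spinor :=
  ∑ j, iAlpha j (fderiv ℝ v x (stdVec j))

lemma integrable_inner_of_continuous {f g : Space3 → Spinor} (hf : Continuous f) (hg : Continuous g)
    (hc : HasCompactSupport g) : Integrable fun x => inner ℝ (f x) (g x) := by
  refine (hf.inner hg).integrable_of_hasCompactSupport (hc.mono fun x hx => ?_)
  contrapose! hx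
  simp only [Function.mem_support, not_not] at hx ⊢
  simp [hx]

/-- Swapping the two directions of differentiation preserves the integral, while anticommutation
flips its sign. -/
lemma integral_inner_cross {v : Space3 → Spinor} (hv : ContDiff ℝ ∞ v) (hc : HasCompactSupport v)
    {j k : Fin 3} (hjk : j ≠ k) :
    ∫ x, inner ℝ (iAlpha j (fderiv ℝ v x (stdVec j))) (iAlpha k (fderiv ℝ v x (stdVec k))) = 0 := by
  have h := integral_bilinear_fderiv_swap (μ := volume) hv hc
    ((innerSL ℝ).bilinearComp (iAlpha j) (iAlpha k)) (stdVec j) (stdVec k)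
  simp only [ContinuousLinearMap.bilinearComp_apply, innerSL_apply_apply] at h
  have h2 : ∀ x, inner ℝ (iAlpha j (fderiv ℝ v x (stdVec k))) (iAlpha k (fderiv ℝ v x (stdVec j)))
      = -inner ℝ (iAlpha j (fderiv ℝ v x (stdVec j))) (iAlpha k (fderiv ℝ v x (stdVec k))) := by
    intro x
    rw [inner_iAlpha_anticomm hjk, real_inner_comm]
  simp only [h2, integral_neg] at h
  linarith

/-- For test spinors the `L²` norms of `∑ j, i α_j ∂_j v` and of the gradient agree. -/
lemma integral_norm_sq_diracOp {v : Space3 → Spinor} (hv : ContDiff ℝ ∞ v)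
    (hc : HasCompactSupport v) :
    ∫ x, ‖diracOp v x‖ ^ 2 = ∑ j, ∫ x, ‖fderiv ℝ v x (stdVec j)‖ ^ 2 := by
  have hcont : ∀ j, Continuous fun x => iAlpha j (fderiv ℝ v x (stdVec j)) := fun j =>
    (iAlpha j).continuous.comp (hv.fderiv_apply_const _).continuous
  have hsupp : ∀ j, HasCompactSupport fun x => iAlpha j (fderiv ℝ v x (stdVec j)) := fun j =>
    (hc.fderiv_apply (𝕜 := ℝ) (stdVec j)).comp_left (g := iAlpha j) (map_zero _)
  have hint : ∀ j k, Integrable fun x =>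
      inner ℝ (iAlpha j (fderiv ℝ v x (stdVec j))) (iAlpha k (fderiv ℝ v x (stdVec k))) :=
    fun j k => integrable_inner_of_continuous (hcont j) (hcont k) (hsupp k)
  simp only [← real_inner_self_eq_norm_sq, diracOp, sum_inner, inner_sum]
  rw [integral_finsetSum _ fun j _ => integrable_finsetSum _ fun k _ => hint _ _]
  refine Finset.sum_congr rfl fun j _ => ?_
  rw [integral_finsetSum _ fun k _ => hint _ _, Finset.sum_eq_single j]
  · simp only [inner_iAlpha_self]
  · intro k _ hk
    exact integral_inner_cross hv hc hk
  · simp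

lemma MeasureTheory.MemLp.eLpNorm_two_le_of_integral_le {α F G : Type*} [MeasurableSpace α]
    {μ : Measure α} [NormedAddCommGroup F] [NormedAddCommGroup G] {f : α → F} {g : α → G}
    (hf : MemLp f 2 μ) (hg : MemLp g 2 μ) (h : ∫ x, ‖f x‖ ^ 2 ∂μ ≤ ∫ x, ‖g x‖ ^ 2 ∂μ) :
    eLpNorm f 2 μ ≤ eLpNorm g 2 μ := by
  rw [hf.eLpNorm_eq_integral_rpow_norm (by simp) (by simp),
    hg.eLpNorm_eq_integral_rpow_norm (by simp) (by simp)]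
  refine ENNReal.ofReal_le_ofReal (Real.rpow_le_rpow ?_ ?_ (by simp))
  · exact integral_nonneg fun x => by positivity
  · simpa using h

lemma norm_clm_le_sum_stdVec {F : Type*} [NormedAddCommGroup F] [NormedSpace ℝ F]
    (T : Space3 →L[ℝ] F) : ‖T‖ ≤ ∑ j, ‖T (stdVec j)‖ := by
  refine T.opNorm_le_bound (by positivity) fun x => ?_
  have hx : x = ∑ j, x j • stdVec j := by
    ext k
    simp [Pi.single_apply]
  conv_lhs => rw [hx, map_sum]
  rw [Finset.sum_mul]
  refine (norm_sum_le _ _).trans (Finset.sum_le_sum fun j _ => ?_)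
  rw [map_smul, norm_smul, mul_comm]
  gcongr
  exact PiLp.norm_apply_le x j

/-! ### Sobolev's inequality for the Dirac operator and mollification -/

/-- The Sobolev inequality with the gradient replaced by the Dirac operator. -/
lemma exists_eLpNorm_six_le_diracOp : ∃ C : ℝ≥0, ∀ v : Space3 → Spinor, ContDiff ℝ ∞ v →
    HasCompactSupport v → eLpNorm v 6 volume ≤ C * eLpNorm (diracOp v) 2 volume := by
  -- The factor 3 counts the partial derivatives, each bounded in L² by the Dirac operator.
  refine ⟨SNormLESNormFDerivOfEqConst Spinor (volume : Measure Space3) 2 * 3, fun v hv hc => ?_⟩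
  have hS := eLpNorm_le_eLpNorm_fderiv_of_eq (volume : Measure Space3) (hv.of_le (by simp)) hc
    (p := 2) (p' := 6) (by norm_num) (by simp) (by simp; norm_num)
  have hcont : ∀ j, Continuous fun x => fderiv ℝ v x (stdVec j) := fun j =>
    (hv.fderiv_apply_const _).continuous
  have hsupp : ∀ j, HasCompactSupport fun x => fderiv ℝ v x (stdVec j) := fun j =>
    hc.fderiv_apply (𝕜 := ℝ) (stdVec j)
  have hmem : ∀ j, MemLp (fun x => fderiv ℝ v x (stdVec j)) 2 volume := fun j =>
    (hcont j).memLp_of_hasCompactSupport (hsupp j)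
  have hD : MemLp (diracOp v) 2 volume := by
    refine memLp_finsetSum _ fun j _ => ?_
    exact ((iAlpha j).continuous.comp (hcont j)).memLp_of_hasCompactSupport
      ((hsupp j).comp_left (g := iAlpha j) (map_zero _))
  have hpart : ∀ j, eLpNorm (fun x => fderiv ℝ v x (stdVec j)) 2 volume ≤
      eLpNorm (diracOp v) 2 volume := fun j => by
    refine (hmem j).eLpNorm_two_le_of_integral_le hD ?_
    rw [integral_norm_sq_diracOp hv hc]
    exact Finset.single_le_sum (f := fun j => ∫ x, ‖fderiv ℝ v x (stdVec j)‖ ^ 2)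
      (fun i _ => integral_nonneg fun x => by positivity) (Finset.mem_univ j)
  have hgrad : eLpNorm (fderiv ℝ v) 2 volume ≤ 3 * eLpNorm (diracOp v) 2 volume := by
    calc eLpNorm (fderiv ℝ v) 2 volume
        ≤ eLpNorm (∑ j, fun x => ‖fderiv ℝ v x (stdVec j)‖) 2 volume :=
          eLpNorm_mono_real fun x => by
            simpa only [Finset.sum_apply] using norm_clm_le_sum_stdVec (fderiv ℝ v x)
      _ ≤ ∑ j, eLpNorm (fun x => ‖fderiv ℝ v x (stdVec j)‖) 2 volume :=
          eLpNorm_sum_le (fun j _ => (hmem j).norm.1) (by simp)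
      _ ≤ ∑ _j : Fin 3, eLpNorm (diracOp v) 2 volume :=
          Finset.sum_le_sum fun j _ => by simpa only [eLpNorm_norm] using hpart j
      _ = 3 * eLpNorm (diracOp v) 2 volume := by simp
  push_cast at hS ⊢
  refine hS.trans ?_
  rw [mul_assoc]
  gcongr

/-- Averaging against a normalized bump function does not increase the `L²` norm. -/
lemma ContDiffBump.eLpNorm_two_convolution_le {F : Type*} [NormedAddCommGroup F] [NormedSpace ℝ F]
    (φ : ContDiffBump (0 : Space3)) {g : Space3 → F} (hg : AEStronglyMeasurable g volume) :
    eLpNorm (φ.normed volume ⋆[ContinuousLinearMap.lsmul ℝ ℝ, volume] g) 2 volume ≤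
      eLpNorm g 2 volume := by
  wlog hgm : StronglyMeasurable g generalizing g
  · have h := this hg.stronglyMeasurable_mk.aestronglyMeasurable hg.stronglyMeasurable_mk
    rwa [← convolution_congr (ContinuousLinearMap.lsmul ℝ ℝ) (EventuallyEq.refl _ _) hg.ae_eq_mk,
      ← eLpNorm_congr_ae hg.ae_eq_mk] at h
  set ρ := φ.normed (volume : Measure Space3)
  have hρm : Measurable fun t => ENNReal.ofReal (ρ t) :=
    (φ.continuous_normed (μ := volume)).measurable.ennreal_ofReal
  -- The bump is a probability density, so Jensen's inequality (Cauchy–Schwarz against 1) bounds the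
  -- square of the average by the average of the square.
  set ν : Measure Space3 := volume.withDensity fun t => ENNReal.ofReal (ρ t) with hν
  have hν1 : ν Set.univ = 1 := by
    rw [hν, withDensity_apply _ MeasurableSet.univ, Measure.restrict_univ,
      ← ofReal_integral_eq_lintegral_ofReal φ.integrable_normed
        (Eventually.of_forall φ.nonneg_normed), φ.integral_normed, ENNReal.ofReal_one]
  have : IsProbabilityMeasure ν := ⟨hν1⟩
  have hgn : Measurable fun x => ‖g x‖ₑ := hgm.enorm
  have hpt : ∀ x, ‖(ρ ⋆[ContinuousLinearMap.lsmul ℝ ℝ, volume] g) x‖ₑ ^ (2 : ℝ) ≤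
      ∫⁻ t, ‖g (x - t)‖ₑ ^ (2 : ℝ) ∂ν := by
    intro x
    have hm : Measurable fun t => ‖g (x - t)‖ₑ := hgn.comp (measurable_const.sub measurable_id)
    have h1 : ‖(ρ ⋆[ContinuousLinearMap.lsmul ℝ ℝ, volume] g) x‖ₑ ≤ ∫⁻ t, ‖g (x - t)‖ₑ ∂ν := by
      rw [hν, lintegral_withDensity_eq_lintegral_mul _ hρm hm]
      refine (enorm_integral_le_lintegral_enorm _).trans_eq (lintegral_congr fun t => ?_)
      simp only [ContinuousLinearMap.lsmul_apply, enorm_smul, Pi.mul_apply]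
      rw [Real.enorm_of_nonneg (φ.nonneg_normed t)]
    have h2 := ENNReal.lintegral_mul_le_Lp_mul_Lq ν Real.HolderConjugate.two_two hm.aemeasurable
      (measurable_const (a := (1 : ℝ≥0∞))).aemeasurable
    simp only [Pi.mul_apply, mul_one, ENNReal.one_rpow, lintegral_one, hν1] at h2
    calc _ ≤ ((∫⁻ t, ‖g (x - t)‖ₑ ^ (2 : ℝ) ∂ν) ^ (1 / 2 : ℝ)) ^ (2 : ℝ) := by
          gcongr
          exact h1.trans h2
      _ = _ := by rw [← ENNReal.rpow_mul]; norm_num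
  rw [eLpNorm_eq_lintegral_rpow_enorm_toReal (by simp) (by simp),
    eLpNorm_eq_lintegral_rpow_enorm_toReal (by simp) (by simp)]
  simp only [ENNReal.toReal_ofNat]
  gcongr 1
  calc _ ≤ ∫⁻ x, ∫⁻ t, ‖g (x - t)‖ₑ ^ (2 : ℝ) ∂ν := lintegral_mono hpt
    _ = ∫⁻ t, ∫⁻ x, ‖g (x - t)‖ₑ ^ (2 : ℝ) ∂volume ∂ν := by
        rw [lintegral_lintegral_swap]
        exact ((hgn.comp (measurable_fst.sub measurable_snd)).pow_const _).aemeasurable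
    _ = ∫⁻ t, ∫⁻ x, ‖g x‖ₑ ^ (2 : ℝ) ∂volume ∂ν := by
        refine lintegral_congr fun t => ?_
        exact lintegral_sub_right_eq_self (fun x => ‖g x‖ₑ ^ (2 : ℝ)) t
    _ = _ := by simp

/-- `∑ j, i α_j ∂_j u = g` on `ℝ³` in the sense of distributions. -/
def IsWeakDiracOp (u g : Space3 → Spinor) : Prop :=
  ∀ ρ : Space3 → ℝ, ContDiff ℝ ∞ ρ → HasCompactSupport ρ →
    ∫ x, ∑ j, fderiv ℝ ρ x (stdVec j) • iAlpha j (u x) = -∫ x, ρ x • g x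

/-- The derivative falls on the kernel; testing the weak equation with t ↦ ρ(x - t) then moves the
operator onto u, the reflection cancelling the minus sign of the weak formulation. -/
lemma IsWeakDiracOp.diracOp_convolution {u g : Space3 → Spinor} (h : IsWeakDiracOp u g)
    (hu : LocallyIntegrable u volume) {ρ : Space3 → ℝ} (hρ : ContDiff ℝ ∞ ρ)
    (hc : HasCompactSupport ρ) :
    diracOp (ρ ⋆[ContinuousLinearMap.lsmul ℝ ℝ, volume] u) =
      ρ ⋆[ContinuousLinearMap.lsmul ℝ ℝ, volume] g := by
  funext x
  have hcd : HasCompactSupport (fderiv ℝ ρ) := hc.fderiv (𝕜 := ℝ)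
  have hint : Integrable fun t => ((ContinuousLinearMap.lsmul ℝ ℝ).precompL Space3
      (fderiv ℝ ρ (x - t))) (u t) :=
    (hcd.convolutionExists_left (μ := volume)
      ((ContinuousLinearMap.lsmul ℝ ℝ).precompL Space3 : _ →L[ℝ] Spinor →L[ℝ] _)
      (hρ.continuous_fderiv (by simp)) hu x).integrable_swap
  have hd := (hc.hasFDerivAt_convolution_left (μ := volume)
    (ContinuousLinearMap.lsmul ℝ ℝ : ℝ →L[ℝ] Spinor →L[ℝ] Spinor) (hρ.of_le (by simp)) hu x).fderiv
  have hintj : ∀ j, Integrable fun t => fderiv ℝ ρ (x - t) (stdVec j) • u t := fun j => by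
    simpa using hint.apply_continuousLinearMap (stdVec j)
  have hj : ∀ j, iAlpha j (fderiv ℝ (ρ ⋆[ContinuousLinearMap.lsmul ℝ ℝ, volume] u) x (stdVec j)) =
      ∫ t, fderiv ℝ ρ (x - t) (stdVec j) • iAlpha j (u t) := by
    intro j
    rw [hd, convolution_eq_swap, ContinuousLinearMap.integral_apply hint,
      ← ContinuousLinearMap.integral_comp_comm]
    · simp
    · exact hintj j
  have hderiv : ∀ t, fderiv ℝ (fun s => ρ (x - s)) t = -fderiv ℝ ρ (x - t) := by
    intro t
    have h1 : HasFDerivAt ρ (fderiv ℝ ρ (x - t)) (x - t) :=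
      (hρ.differentiable (by simp) _).hasFDerivAt
    have h2 : HasFDerivAt (fun s => ρ (x - s)) _ t := h1.comp t ((hasFDerivAt_id t).const_sub x)
    rw [h2.fderiv]
    ext
    simp
  have hw := h (fun t => ρ (x - t)) (hρ.comp (contDiff_const.sub contDiff_id))
    (hc.comp_homeomorph (Homeomorph.subLeft x))
  simp only [hderiv, neg_apply, neg_smul, Finset.sum_neg_distrib,
    integral_neg, neg_inj] at hw
  rw [convolution_eq_swap]
  simp only [ContinuousLinearMap.lsmul_apply, diracOp, hj]
  rw [← hw, integral_finsetSum]
  intro j _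
  simpa using (iAlpha j).integrable_comp (hintj j)

/-- A compactly supported `u ∈ L¹_loc` with `∑ j, i α_j ∂_j u = g ∈ L²` belongs to `L⁶`. -/
lemma exists_eLpNorm_six_le_of_isWeakDiracOp : ∃ C : ℝ≥0, ∀ u g : Space3 → Spinor,
    LocallyIntegrable u volume → HasCompactSupport u → AEStronglyMeasurable g volume →
    IsWeakDiracOp u g → eLpNorm u 6 volume ≤ C * eLpNorm g 2 volume := by
  obtain ⟨C, hC⟩ := exists_eLpNorm_six_le_diracOp
  refine ⟨C, fun u g hu huc hg h => ?_⟩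
  -- The fixed ratio 2 of outer to inner radius is what gives a.e. convergence of the
  -- mollifications; Fatou's lemma then passes the L⁶ bound to the limit.
  let φ : ℕ → ContDiffBump (0 : Space3) := fun n =>
    ⟨1 / (n + 1), 2 / (n + 1), by positivity, by gcongr; norm_num⟩
  have hφ : Tendsto (fun n => (φ n).rOut) atTop (𝓝 0) := by
    have := (tendsto_one_div_add_atTop_nhds_zero_nat (𝕜 := ℝ)).const_mul 2
    simpa [φ, div_eq_mul_inv] using this
  have hlim := ContDiffBump.ae_convolution_tendsto_right_of_locallyIntegrable (φ := φ) (K := 2)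
    (μ := volume) hφ (Eventually.of_forall fun n => by simp [φ, div_eq_mul_inv]) hu
  have hsm : ∀ n, ContDiff ℝ ∞
      ((φ n).normed volume ⋆[ContinuousLinearMap.lsmul ℝ ℝ, volume] u) := fun n =>
    (φ n).hasCompactSupport_normed.contDiff_convolution_left _ (φ n).contDiff_normed hu
  refine (Lp.eLpNorm_lim_le_liminf_eLpNorm (p := 6)
    (fun n => (hsm n).continuous.aestronglyMeasurable) u hlim).trans ?_
  refine liminf_le_of_le (by isBoundedDefault) fun b hb => ?_
  obtain ⟨n, hn⟩ := hb.exists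
  refine hn.trans ((hC _ (hsm n) (HasCompactSupport.convolution _
    (φ n).hasCompactSupport_normed huc)).trans ?_)
  rw [h.diracOp_convolution hu (φ n).contDiff_normed (φ n).hasCompactSupport_normed]
  gcongr
  exact (φ n).eLpNorm_two_convolution_le hg


/-! ### The equation for a truncated solution -/

lemma measurableSet_ballCompl (r : ℝ) : MeasurableSet (ballCompl r) :=
  measurableSet_le measurable_const measurable_norm

lemma spinorPair_smul_single (z : Spinor) (c : ℝ) (k : Fin 4) :
    spinorPair z (c • EuclideanSpace.single k 1) = c • z k := by
  simp [spinorPair, apply_ite (starRingEnd ℂ), mul_comm]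

/-- Since α_j is Hermitian and the pairing conjugates -i to i, testing against h e_k reads off one
component of the real-linear operator. -/
lemma spinorPair_alphaDotP_smul_single (z : Spinor) {h : Space3 → ℝ} (hh : Differentiable ℝ h)
    (k : Fin 4) (x : Space3) :
    spinorPair z (alphaDotP (fun y => h y • (EuclideanSpace.single k 1 : Spinor)) x) =
      (∑ j, fderiv ℝ h x (stdVec j) • iAlpha j z) k := by
  have hd : ∀ e, fderiv ℝ (fun y => h y • (EuclideanSpace.single k 1 : Spinor)) x e =
      fderiv ℝ h x e • (EuclideanSpace.single k 1 : Spinor) := by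
    intro e
    rw [fderiv_smul_const (hh x)]
    simp
  simp only [alphaDotP, hd, spinorPair, matAct]
  fin_cases k <;>
  simp [iAlpha_apply, diracAlpha_eq, Fin.sum_univ_three, Fin.sum_univ_four] <;>
  ring_nf <;> simp only [Complex.I_sq] <;> ring

lemma norm_matAct_le {A : Matrix (Fin 4) (Fin 4) ℂ} {c : ℝ} (hA : ∀ i j, ‖A i j‖ ≤ c)
    (z : Spinor) : ‖matAct A z‖ ≤ 16 * c * ‖z‖ := by
  have hsum : matAct A z = ∑ i, EuclideanSpace.single i ((A *ᵥ z.ofLp) i) := by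
    ext k
    simp [matAct, Pi.single_apply]
  rw [hsum]
  calc ‖∑ i, EuclideanSpace.single i ((A *ᵥ z.ofLp) i)‖
      ≤ ∑ i : Fin 4, ‖(EuclideanSpace.single i ((A *ᵥ z.ofLp) i) : Spinor)‖ := norm_sum_le _ _
    _ ≤ ∑ _i : Fin 4, ∑ _j : Fin 4, c * ‖z‖ := by
        refine Finset.sum_le_sum fun i _ => ?_
        rw [PiLp.norm_single, Matrix.mulVec, dotProduct]
        refine (norm_sum_le _ _).trans (Finset.sum_le_sum fun j _ => ?_)
        rw [norm_mul]
        gcongr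
        · exact (norm_nonneg _).trans (hA i j)
        · exact hA i j
        · exact PiLp.norm_apply_le z j
    _ = 16 * c * ‖z‖ := by simp; ring

lemma MeasureTheory.MemLp.integrable_smul_of_hasCompactSupport {c : Space3 → ℝ}
    {z : Space3 → Spinor}
    (hz : MemLp z 2 volume) (hc : Continuous c) (hs : HasCompactSupport c) :
    Integrable fun x => c x • z x :=
  memLp_one_iff_integrable.1
    (hz.smul (r := 1) (hc.memLp_of_hasCompactSupport (μ := volume) (p := 2) hs))

namespace IsL2ExteriorSolution

variable {r : ℝ} {Q : Space3 → Matrix (Fin 4) (Fin 4) ℂ} {ψ : Space3 → Spinor}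

lemma memLp_indicator (hψ : IsL2ExteriorSolution r Q ψ) :
    MemLp ((ballCompl r).indicator ψ) 2 volume :=
  (memLp_indicator_iff_restrict (measurableSet_ballCompl r)).2 hψ.memLp_two

lemma aestronglyMeasurable_potential (hψ : IsL2ExteriorSolution r Q ψ) :
    AEStronglyMeasurable ((ballCompl r).indicator fun x => matAct (Q x) (ψ x)) volume := by
  rw [aestronglyMeasurable_indicator_iff (measurableSet_ballCompl r)]
  have hψk : ∀ k, AEStronglyMeasurable (fun x => ψ x k) (volume.restrict (ballCompl r)) :=
    fun k => (EuclideanSpace.proj (𝕜 := ℂ) k).continuous.comp_aestronglyMeasurable hψ.memLp_two.1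
  have hsum : (fun x => matAct (Q x) (ψ x)) = fun x =>
      ∑ i, ∑ j, (Q x i j * ψ x j) • (EuclideanSpace.single i 1 : Spinor) := by
    funext x
    ext k
    simp [matAct, Matrix.mulVec, dotProduct, Pi.single_apply, Finset.sum_ite_eq]
  rw [hsum]
  refine Finset.aestronglyMeasurable_fun_sum _ fun i _ =>
    Finset.aestronglyMeasurable_fun_sum _ fun j _ => ?_
  exact ((hψ.potential_measurable i j).mul (hψk j)).smul_const _

/-- The potential term is dominated by `|x|⁻¹ |ψ|`. -/
lemma exists_norm_potential_le (hψ : IsL2ExteriorSolution r Q ψ) :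
    ∃ K : ℝ, 0 ≤ K ∧ ∀ᵐ x, ‖(ballCompl r).indicator (fun x => matAct (Q x) (ψ x)) x‖ ≤
      K * ‖x‖⁻¹ * ‖(ballCompl r).indicator ψ x‖ := by
  obtain ⟨C, hC⟩ := hψ.potential_bound
  refine ⟨16 * |C|, by positivity, ?_⟩
  rw [ae_restrict_iff' (measurableSet_ballCompl r)] at hC
  filter_upwards [hC] with x hx
  by_cases hxr : x ∈ ballCompl r
  · simp only [Set.indicator_of_mem hxr]
    have := norm_matAct_le (c := |C| * ‖x‖⁻¹) (fun i j => (hx hxr i j).trans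
      (by gcongr; exact le_abs_self C)) (ψ x)
    simpa only [mul_assoc] using this
  · simp [Set.indicator_of_notMem hxr]

/-- The distribution `∑ j, i α_j ∂_j (w ψ)` for a cut-off function `w`. -/
lemma isWeakDiracOp_smul (hr : 0 < r) (hψ : IsL2ExteriorSolution r Q ψ) {w : Space3 → ℝ}
    (hw : ContDiff ℝ ∞ w) (hwc : HasCompactSupport w) (hws : tsupport w ⊆ {x | r < ‖x‖}) :
    IsWeakDiracOp (fun x => w x • (ballCompl r).indicator ψ x) (fun x =>
      (∑ j, fderiv ℝ w x (stdVec j) • iAlpha j ((ballCompl r).indicator ψ x)) +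
        w x • (ballCompl r).indicator (fun x => matAct (Q x) (ψ x)) x) := by
  intro ρ hρ hρc
  set ψ' := (ballCompl r).indicator ψ
  set q := (ballCompl r).indicator (fun x => matAct (Q x) (ψ x))
  have hψL : MemLp ψ' 2 volume := hψ.memLp_indicator
  have hqL : MemLp q 2 volume := by
    obtain ⟨K, hK, hb⟩ := hψ.exists_norm_potential_le
    refine hψL.of_le_mul (c := K * r⁻¹) hψ.aestronglyMeasurable_potential ?_
    filter_upwards [hb] with x hx
    by_cases hxr : x ∈ ballCompl r
    · have hxr' : r ≤ ‖x‖ := hxr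
      exact hx.trans (by gcongr)
    · simp only [q, Set.indicator_of_notMem hxr, norm_zero]
      positivity
  have hAL : ∀ j, MemLp (fun x => iAlpha j (ψ' x)) 2 volume := fun j =>
    (iAlpha j).comp_memLp' hψL
  have hdρ : ∀ j, Continuous fun x => fderiv ℝ ρ x (stdVec j) := fun j =>
    (hρ.fderiv_apply_const _).continuous
  have hdw : ∀ j, Continuous fun x => fderiv ℝ w x (stdVec j) := fun j =>
    (hw.fderiv_apply_const _).continuous
  have i1 : ∀ j, Integrable fun x => (fderiv ℝ ρ x (stdVec j) * w x) • iAlpha j (ψ' x) := fun j =>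
    (hAL j).integrable_smul_of_hasCompactSupport ((hdρ j).mul hw.continuous) hwc.mul_left
  have i2 : ∀ j, Integrable fun x => (fderiv ℝ w x (stdVec j) * ρ x) • iAlpha j (ψ' x) := fun j =>
    (hAL j).integrable_smul_of_hasCompactSupport ((hdw j).mul hρ.continuous) hρc.mul_left
  have i3 : Integrable fun x => (w x * ρ x) • q x :=
    hqL.integrable_smul_of_hasCompactSupport (hw.continuous.mul hρ.continuous) hρc.mul_left
  have e1 : (fun x => ∑ j, fderiv ℝ ρ x (stdVec j) • iAlpha j (w x • ψ' x)) =
      fun x => ∑ j, (fderiv ℝ ρ x (stdVec j) * w x) • iAlpha j (ψ' x) := by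
    funext x
    simp only [map_smul, smul_smul]
  have e2 : (fun x => ρ x • ((∑ j, fderiv ℝ w x (stdVec j) • iAlpha j (ψ' x)) + w x • q x)) =
      fun x => (∑ j, (fderiv ℝ w x (stdVec j) * ρ x) • iAlpha j (ψ' x)) + (w x * ρ x) • q x := by
    funext x
    simp only [smul_add, Finset.smul_sum, smul_smul, mul_comm]
  have I1 : Integrable fun x => ∑ j, fderiv ℝ ρ x (stdVec j) • iAlpha j (w x • ψ' x) := by
    rw [e1]
    exact integrable_finsetSum _ fun j _ => i1 j
  have I2 : Integrable fun x =>
      ρ x • ((∑ j, fderiv ℝ w x (stdVec j) • iAlpha j (ψ' x)) + w x • q x) := by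
    rw [e2]
    exact (integrable_finsetSum _ fun j _ => i2 j).add i3
  rw [eq_neg_iff_add_eq_zero, ← integral_add I1 I2]
  have hh : ContDiff ℝ ∞ fun x => w x * ρ x := hw.mul hρ
  have hts : tsupport (fun x => w x * ρ x) ⊆ tsupport w := tsupport_mul_subset_left
  ext k
  have hproj := (EuclideanSpace.proj (𝕜 := ℂ) k : Spinor →L[ℂ] ℂ).integral_comp_comm
    (I1.add I2)
  refine hproj.symm.trans ?_
  -- The vector identity is checked componentwise, with wρ e_k as test spinor.
  have htest : IsTestSpinor {x | r < ‖x‖}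
      fun x => (w x * ρ x) • (EuclideanSpace.single k 1 : Spinor) := by
    have hsub : (Function.support fun x => (w x * ρ x) • (EuclideanSpace.single k 1 : Spinor)) ⊆
        Function.support fun x => w x * ρ x := by
      intro x hx hx0
      exact hx (by simp only at hx0 ⊢; rw [hx0, zero_smul])
    exact ⟨hh.smul contDiff_const, hρc.mul_left.mono hsub,
      (closure_mono hsub).trans (hts.trans hws)⟩
  have hweak := hψ.weak_solution _ htest
  rw [setIntegral_eq_integral_of_forall_compl_eq_zero] at hweak
  · refine Eq.trans (integral_congr_ae (Eventually.of_forall fun x => ?_)) hweak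
    simp only [spinorPair_smul_single,
      spinorPair_alphaDotP_smul_single _ (hh.differentiable (by simp))]
    rw [fderiv_fun_mul (hw.differentiable (by simp) x) (hρ.differentiable (by simp) x)]
    by_cases hxr : x ∈ ballCompl r
    · have hxψ : ψ' x = ψ x := Set.indicator_of_mem hxr _
      have hxq : q x = matAct (Q x) (ψ x) := Set.indicator_of_mem hxr _
      simp only [Pi.add_apply, hxψ, hxq, Fin.sum_univ_three]
      simp
      ring
    · have hxw : x ∉ tsupport w := fun hx => hxr (le_of_lt (hws hx) : r ≤ ‖x‖)
      have h0 : w x = 0 := image_eq_zero_of_notMem_tsupport hxw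
      have h1 : fderiv ℝ w x = 0 :=
        image_eq_zero_of_notMem_tsupport fun hx => hxw (tsupport_fderiv_subset ℝ hx)
      simp [h0, h1]
  · intro x hx
    have hxw : x ∉ tsupport fun x => w x * ρ x := fun h => hx (hws (hts h))
    have h0 : w x * ρ x = 0 :=
      image_eq_zero_of_notMem_tsupport (f := fun x => w x * ρ x) hxw
    have h1 : fderiv ℝ (fun x => w x * ρ x) x = 0 :=
      image_eq_zero_of_notMem_tsupport fun hx => hxw (tsupport_fderiv_subset ℝ hx)
    rw [spinorPair_alphaDotP_smul_single _ (hh.differentiable (by simp)), spinorPair_smul_single,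
      h0, h1]
    simp

/-- Cut-offs of linear growth with bounded gradient give uniform `L⁶` bounds. -/
lemma exists_eLpNorm_six_smul_le (hr : 0 < r) (hψ : IsL2ExteriorSolution r Q ψ) {M : ℝ} :
    ∃ B : ℝ≥0∞, B < ⊤ ∧ ∀ w : Space3 → ℝ, ContDiff ℝ ∞ w → HasCompactSupport w →
      tsupport w ⊆ {x | r < ‖x‖} → (∀ x, ‖fderiv ℝ w x‖ ≤ M) → (∀ x, ‖w x‖ ≤ M * ‖x‖) →
      eLpNorm (fun x => w x • (ballCompl r).indicator ψ x) 6 volume ≤ B := by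
  obtain ⟨C, hC⟩ := exists_eLpNorm_six_le_of_isWeakDiracOp
  obtain ⟨K, hK, hb⟩ := hψ.exists_norm_potential_le
  have hψL := hψ.memLp_indicator
  -- 3M bounds the three gradient terms; in MK the growth M|x| of w cancels the decay K|x|⁻¹ of the
  -- potential.
  refine ⟨C * (ENNReal.ofReal (3 * M + M * K) * eLpNorm ((ballCompl r).indicator ψ) 2 volume),
    ENNReal.mul_lt_top ENNReal.coe_lt_top (ENNReal.mul_lt_top ENNReal.ofReal_lt_top hψL.2),
    fun w hw hwc hws hdM hwM => ?_⟩
  have hM : 0 ≤ M := (norm_nonneg _).trans (hdM 0)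
  refine (hC _ _ ?_ ?_ ?_ (hψ.isWeakDiracOp_smul hr hw hwc hws)).trans ?_
  · exact (hψL.integrable_smul_of_hasCompactSupport hw.continuous hwc).locallyIntegrable
  · exact hwc.mono (Function.support_smul_subset_left w _)
  · refine AEStronglyMeasurable.add (Finset.aestronglyMeasurable_fun_sum _ fun j _ => ?_) ?_
    · exact (hw.fderiv_apply_const (stdVec j)).continuous.aestronglyMeasurable.smul
        ((iAlpha j).continuous.comp_aestronglyMeasurable hψL.1)
    · exact hw.continuous.aestronglyMeasurable.smul hψ.aestronglyMeasurable_potential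
  · gcongr
    refine eLpNorm_le_mul_eLpNorm_of_ae_le_mul ?_ 2
    filter_upwards [hb] with x hx
    refine (norm_add_le _ _).trans ?_
    rw [add_mul]
    gcongr
    · refine (norm_sum_le _ _).trans ?_
      calc _ ≤ ∑ _j : Fin 3, M * ‖(ballCompl r).indicator ψ x‖ := by
            refine Finset.sum_le_sum fun j _ => ?_
            rw [norm_smul, norm_iAlpha]
            gcongr
            refine ((fderiv ℝ w x).le_opNorm _).trans ?_
            simpa using hdM x
        _ = _ := by simp; ring
    · rw [norm_smul]
      calc _ ≤ (M * ‖x‖) * (K * ‖x‖⁻¹ * ‖(ballCompl r).indicator ψ x‖) := by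
            gcongr
            exact hwM x
        _ = (‖x‖ * ‖x‖⁻¹) * (M * K * ‖(ballCompl r).indicator ψ x‖) := by ring
        _ ≤ 1 * (M * K * ‖(ballCompl r).indicator ψ x‖) := by
            gcongr
            exact mul_inv_le_one
        _ = _ := one_mul _

end IsL2ExteriorSolution

/-! ### Cut-offs of the coordinate functions -/

/-- Compactly supported cut-offs outside a ball that exhaust the `i`-th coordinate function,
with linear growth and gradients bounded uniformly. -/
lemma exists_coordinate_cutoff {r R : ℝ} (hr : 0 < r) (hrR : r < R) (i : Fin 3) :
    ∃ (M : ℝ) (w : ℕ → Space3 → ℝ), (∀ n, ContDiff ℝ ∞ (w n) ∧ HasCompactSupport (w n) ∧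
      tsupport (w n) ⊆ {x | r < ‖x‖} ∧ (∀ x, ‖fderiv ℝ (w n) x‖ ≤ M) ∧
      ∀ x, ‖w n x‖ ≤ M * ‖x‖) ∧
      ∀ x ∈ ballCompl R, ∀ᶠ n in atTop, w n x = x i := by
  let χ : ContDiffBump (0 : Space3) := ⟨1, 2, by norm_num, by norm_num⟩
  -- θ = 1 up to radius (r + R)/2, which keeps the support of 1 - θ strictly outside radius r.
  let θ : ContDiffBump (0 : Space3) := ⟨(r + R) / 2, R, by linarith, by linarith⟩
  have hcoord : ContDiff ℝ ∞ fun y : Space3 => y i :=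
    (EuclideanSpace.proj (𝕜 := ℝ) i : Space3 →L[ℝ] ℝ).contDiff
  have hxi : ∀ y : Space3, |y i| ≤ ‖y‖ := fun y => PiLp.norm_apply_le y i
  let ζ : Space3 → ℝ := fun y => χ y * y i
  have hζ : ContDiff ℝ ∞ ζ := χ.contDiff.mul hcoord
  have hζc : HasCompactSupport ζ := χ.hasCompactSupport.mul_right
  have hζle : ∀ y, |ζ y| ≤ ‖y‖ := fun y => by
    rw [abs_mul, abs_of_nonneg χ.nonneg]
    exact (mul_le_of_le_one_left (abs_nonneg _) χ.le_one).trans (hxi y)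
  have hθ : ContDiff ℝ ∞ θ := θ.contDiff
  let η : Space3 → ℝ := fun x => 1 - θ x
  have hη : ContDiff ℝ ∞ η := contDiff_const.sub hθ
  have hηle : ∀ x, |η x| ≤ 1 := fun x => by
    rw [abs_le]
    constructor <;> linarith [θ.nonneg (x := x), θ.le_one (x := x)]
  have hdη : ∀ x, fderiv ℝ η x = -fderiv ℝ θ x := fun x => by
    simp only [η]
    rw [fderiv_const_sub]
  obtain ⟨M₁, hM₁⟩ := (hζc.fderiv (𝕜 := ℝ)).exists_bound_of_continuous
    (hζ.continuous_fderiv (by simp))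
  -- The weight |x| is needed because ∇θ will multiply a truncated coordinate of size at most |x|.
  obtain ⟨M₂, hM₂⟩ := ((θ.hasCompactSupport.fderiv (𝕜 := ℝ)).smul_left
    (f := fun x : Space3 => ‖x‖)).exists_bound_of_continuous
    (continuous_norm.smul (hθ.continuous_fderiv (by simp)))
  have hM₁0 : 0 ≤ M₁ := (norm_nonneg _).trans (hM₁ 0)
  have hM₂0 : 0 ≤ M₂ := (norm_nonneg _).trans (hM₂ 0)
  -- Dilating ζ to s ζ(x/s) preserves both its gradient bound and its linear growth bound; the shift
  -- by 1 keeps s positive at n = 0.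
  let s : ℕ → ℝ := fun n => n + 1
  have hs : ∀ n, 0 < s n := fun n => by positivity
  have hscaled : ∀ n, ContDiff ℝ ∞ fun x => s n * ζ ((s n)⁻¹ • x) := fun n =>
    contDiff_const.mul (hζ.comp (contDiff_const_smul _))
  have hscaled_le : ∀ n x, |s n * ζ ((s n)⁻¹ • x)| ≤ ‖x‖ := fun n x => by
    rw [abs_mul, abs_of_pos (hs n)]
    calc s n * |ζ ((s n)⁻¹ • x)| ≤ s n * ‖(s n)⁻¹ • x‖ := by
          gcongr
          exact hζle _
      _ = ‖x‖ := by
          rw [norm_smul, norm_inv, Real.norm_of_nonneg (hs n).le, mul_inv_cancel_left₀ (hs n).ne']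
  have hscaled_d : ∀ n x, fderiv ℝ (fun x => s n * ζ ((s n)⁻¹ • x)) x =
      fderiv ℝ ζ ((s n)⁻¹ • x) := fun n x => by
    have h1 : HasFDerivAt ζ (fderiv ℝ ζ ((s n)⁻¹ • x)) ((s n)⁻¹ • x) :=
      (hζ.differentiable (by simp) _).hasFDerivAt
    have h2 : HasFDerivAt (fun x => s n * ζ ((s n)⁻¹ • x)) _ x :=
      (h1.comp x ((hasFDerivAt_id x).const_smul ((s n)⁻¹))).const_mul (s n)
    rw [h2.fderiv]
    ext e
    simp [mul_inv_cancel_left₀ (hs n).ne']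
  refine ⟨1 + M₁ + M₂, fun n x => η x * (s n * ζ ((s n)⁻¹ • x)), fun n => ⟨?_, ?_, ?_, ?_, ?_⟩, ?_⟩
  · exact hη.mul (hscaled n)
  · exact ((hζc.comp_smul (inv_ne_zero (hs n).ne')).mul_left).mul_left
  · refine tsupport_mul_subset_left.trans ?_
    have hcl : IsClosed {x : Space3 | (r + R) / 2 ≤ ‖x‖} := isClosed_le continuous_const
      continuous_norm
    refine (closure_minimal (fun x hx => ?_) hcl).trans fun x hx => ?_
    · by_contra hlt
      refine hx ?_
      have : θ x = 1 := θ.one_of_mem_closedBall (by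
        rw [mem_closedBall_zero_iff]
        exact (not_le.1 hlt).le)
      simp [η, this]
    · simp only [Set.mem_ofPred_eq] at hx ⊢
      linarith
  · intro x
    rw [fderiv_fun_mul (hη.differentiable (by simp) x) ((hscaled n).differentiable (by simp) x),
      hscaled_d, hdη]
    refine (norm_add_le _ _).trans ?_
    rw [norm_smul, norm_smul, norm_neg, Real.norm_eq_abs, Real.norm_eq_abs]
    have h1 : |η x| * ‖fderiv ℝ ζ ((s n)⁻¹ • x)‖ ≤ M₁ :=
      (mul_le_of_le_one_left (norm_nonneg _) (hηle x)).trans (hM₁ _)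
    have h2 : |s n * ζ ((s n)⁻¹ • x)| * ‖fderiv ℝ θ x‖ ≤ M₂ := by
      refine le_trans ?_ (hM₂ x)
      rw [Pi.smul_apply', norm_smul, norm_norm]
      gcongr
      exact hscaled_le n x
    linarith
  · intro x
    rw [norm_mul, Real.norm_eq_abs, Real.norm_eq_abs]
    calc |η x| * |s n * ζ ((s n)⁻¹ • x)| ≤ 1 * ‖x‖ := by
          gcongr
          · exact hηle x
          · exact hscaled_le n x
      _ ≤ (1 + M₁ + M₂) * ‖x‖ := by
          gcongr
          linarith
  · intro x (hx : R ≤ ‖x‖)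
    filter_upwards [eventually_ge_atTop ⌈‖x‖⌉₊] with n hn
    have hθx : θ x = 0 := θ.zero_of_le_dist (by simpa using hx)
    have hχx : χ ((s n)⁻¹ • x) = 1 := by
      refine χ.one_of_mem_closedBall ?_
      rw [mem_closedBall_zero_iff, norm_smul, norm_inv, Real.norm_of_nonneg (hs n).le,
        inv_mul_le_iff₀ (hs n), mul_one]
      exact (Nat.ceil_le.1 hn).trans (by simp [s])
    simp [η, ζ, hθx, hχx, mul_inv_cancel_left₀ (hs n).ne']

/-! ### The weighted L⁶ estimate -/

namespace IsL2ExteriorSolution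

variable {r R : ℝ} {Q : Space3 → Matrix (Fin 4) (Fin 4) ℂ} {ψ : Space3 → Spinor}

/-- The weighted regularity estimate: `|x| ψ ∈ L⁶` away from the inner boundary. -/
theorem integrableOn_norm_mul_pow_six (hr : 0 < r) (hrR : r < R)
    (hψ : IsL2ExteriorSolution r Q ψ) :
    IntegrableOn (fun x => (‖x‖ * ‖ψ x‖) ^ 6) (ballCompl R) := by
  have hsub : ballCompl R ⊆ ballCompl r := fun x (hx : R ≤ ‖x‖) => hrR.le.trans hx
  have hψm : AEStronglyMeasurable ψ (volume.restrict (ballCompl R)) :=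
    hψ.memLp_two.1.mono_set hsub
  have hcoord : ∀ i, MemLp (fun x => x i • ψ x) 6 (volume.restrict (ballCompl R)) := by
    intro i
    obtain ⟨M, w, hw, hlim⟩ := exists_coordinate_cutoff hr hrR i
    obtain ⟨B, hB, hwB⟩ := hψ.exists_eLpNorm_six_smul_le hr (M := M)
    have hxm : Continuous fun x : Space3 => x i :=
      (EuclideanSpace.proj (𝕜 := ℝ) i : Space3 →L[ℝ] ℝ).continuous
    refine ⟨hxm.aestronglyMeasurable.smul hψm, lt_of_le_of_lt ?_ hB⟩
    refine (Lp.eLpNorm_lim_le_liminf_eLpNorm (p := 6)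
      (f := fun n x => w n x • (ballCompl r).indicator ψ x)
      (fun n => (hw n).1.continuous.aestronglyMeasurable.smul hψ.memLp_indicator.1.restrict) _
      ?_).trans ?_
    · refine (ae_restrict_iff' (measurableSet_ballCompl R)).2 (Eventually.of_forall fun x hx => ?_)
      refine tendsto_const_nhds.congr' ?_
      filter_upwards [hlim x hx] with n hn
      rw [hn, Set.indicator_of_mem (hsub hx)]
    · refine liminf_le_of_le (by isBoundedDefault) fun b hb => ?_
      obtain ⟨n, hn⟩ := hb.exists
      obtain ⟨h1, h2, h3, h4, h5⟩ := hw n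
      exact hn.trans ((eLpNorm_mono_measure _ Measure.restrict_le_self).trans
        (hwB _ h1 h2 h3 h4 h5))
  have hsum : MemLp (fun x => ∑ i, ‖x i • ψ x‖) 6 (volume.restrict (ballCompl R)) :=
    memLp_finsetSum _ fun i _ => (hcoord i).norm
  have hmem : MemLp (fun x => ‖x‖ • ψ x) 6 (volume.restrict (ballCompl R)) := by
    refine hsum.mono' (continuous_norm.aestronglyMeasurable.smul hψm)
      (Eventually.of_forall fun x => ?_)
    have hx : ‖x‖ ≤ ∑ i, ‖x i‖ := by
      conv_lhs => rw [show x = ∑ i, x i • stdVec i by ext k; simp [Pi.single_apply]]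
      refine (norm_sum_le _ _).trans (Finset.sum_le_sum fun i _ => ?_)
      rw [norm_smul]
      simp
    simp only [norm_smul, norm_norm, ← Finset.sum_mul]
    gcongr
  have := hmem.integrable_norm_pow (p := 6) (by norm_num)
  simpa only [norm_smul, norm_norm, IntegrableOn] using this

end IsL2ExteriorSolution

/-! ### Moments against |x|⁻⁶ -/

lemma integrableOn_norm_pow_six_inv :
    IntegrableOn (fun x : Space3 => (‖x‖ ^ 6)⁻¹) (ballCompl 1) := by
  have h : Integrable (fun x : Space3 => 2 ^ 6 * (1 + ‖x‖) ^ (-(6 : ℝ))) :=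
    (integrable_one_add_norm (by simp; norm_num)).const_mul _
  refine h.integrableOn.mono' (measurable_norm.pow_const 6).inv.aestronglyMeasurable ?_
  refine (ae_restrict_iff' (measurableSet_ballCompl 1)).2 (Eventually.of_forall fun x hx => ?_)
  have hx1 : 1 ≤ ‖x‖ := hx
  rw [Real.norm_of_nonneg (by positivity), Real.rpow_neg (by positivity),
    show (6 : ℝ) = (6 : ℕ) by norm_num, Real.rpow_natCast, ← div_eq_mul_inv,
    inv_eq_one_div, div_le_div_iff₀ (by positivity) (by positivity), one_mul, ← mul_pow]
  gcongr
  linarith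

lemma Real.rpow_le_one_add_pow {a k : ℝ} {m : ℕ} (ha : 0 ≤ a) (hk : 0 ≤ k) (hkm : k ≤ m) :
    a ^ k ≤ 1 + a ^ m := by
  rcases le_total a 1 with h | h
  · have := Real.rpow_le_one ha h hk
    have : 0 ≤ a ^ m := by positivity
    linarith
  · have := Real.rpow_le_rpow_of_exponent_le h hkm
    rw [Real.rpow_natCast] at this
    linarith

/-- If `|x|² ψ` has an `m`-th moment against `|x|⁻⁶`, it has all smaller ones. -/
lemma integrableOn_rpow_of_pow {s : Set Space3} (hs : MeasurableSet s) (hs1 : s ⊆ ballCompl 1)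
    {ψ : Space3 → Spinor} (hψ : AEStronglyMeasurable ψ (volume.restrict s)) {m : ℕ} {k : ℝ}
    (hk : 0 ≤ k) (hkm : k ≤ m)
    {G : Space3 → ℝ} (hG : IntegrableOn G s)
    (hle : ∀ x ∈ s, ‖‖x‖ ^ 2 • ψ x‖ ^ m * (‖x‖ ^ 6)⁻¹ ≤ G x) :
    IntegrableOn (fun x => ‖‖x‖ ^ 2 • ψ x‖ ^ k * (‖x‖ ^ 6)⁻¹) s := by
  -- The dominating function comes from t^k ≤ 1 + t^m.
  refine ((integrableOn_norm_pow_six_inv.mono_set hs1).add hG).mono' ?_ ?_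
  · have h1 : AEStronglyMeasurable (fun x => ‖‖x‖ ^ 2 • ψ x‖) (volume.restrict s) :=
      ((continuous_norm.pow 2).aestronglyMeasurable.smul hψ).norm
    exact ((h1.aemeasurable.pow_const k).mul
      (measurable_norm.pow_const 6).inv.aemeasurable).aestronglyMeasurable
  · refine (ae_restrict_iff' hs).2 (Eventually.of_forall fun x hx => ?_)
    rw [Real.norm_of_nonneg (by positivity)]
    calc _ ≤ (1 + ‖‖x‖ ^ 2 • ψ x‖ ^ m) * (‖x‖ ^ 6)⁻¹ := by
          gcongr
          exact Real.rpow_le_one_add_pow (norm_nonneg _) hk hkm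
      _ = (‖x‖ ^ 6)⁻¹ + ‖‖x‖ ^ 2 • ψ x‖ ^ m * (‖x‖ ^ 6)⁻¹ := by ring
      _ ≤ _ := by
          simp only [Pi.add_apply]
          gcongr
          exact hle x hx

namespace IsL2ExteriorSolution

variable {r R : ℝ} {Q : Space3 → Matrix (Fin 4) (Fin 4) ℂ} {ψ : Space3 → Spinor}

lemma integrableOn_of_le_six (hr : 0 < r) (hrR : r < R) (hR : 1 ≤ R)
    (hψ : IsL2ExteriorSolution r Q ψ) {k : ℝ} (hk : 0 ≤ k) (hk6 : k ≤ 6) :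
    IntegrableOn (fun x => ‖‖x‖ ^ 2 • ψ x‖ ^ k * (‖x‖ ^ 6)⁻¹) (ballCompl R) := by
  refine integrableOn_rpow_of_pow (m := 6) (measurableSet_ballCompl R)
    (fun x (hx : R ≤ ‖x‖) => hR.trans hx)
    (hψ.memLp_two.1.mono_set fun x (hx : R ≤ ‖x‖) => hrR.le.trans hx) hk (by exact_mod_cast hk6)
    (hψ.integrableOn_norm_mul_pow_six hr hrR) fun x (hx : R ≤ ‖x‖) => ?_
  have h0 : 0 < ‖x‖ := by linarith
  rw [norm_smul, norm_pow, norm_norm]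
  apply le_of_eq
  field_simp

/-- Here |φ|²|x|⁻⁶ = |x|⁻²|ψ|² ≤ |ψ|², so no regularity near the unit sphere enters. -/
lemma integrableOn_of_le_two (hψ : IsL2ExteriorSolution 1 Q ψ) {k : ℝ} (hk : 0 ≤ k)
    (hk2 : k ≤ 2) :
    IntegrableOn (fun x => ‖‖x‖ ^ 2 • ψ x‖ ^ k * (‖x‖ ^ 6)⁻¹) (ballCompl 1) := by
  refine integrableOn_rpow_of_pow (m := 2) (measurableSet_ballCompl 1) subset_rfl hψ.memLp_two.1
    hk (by exact_mod_cast hk2) (hψ.memLp_two.integrable_norm_pow (p := 2) (by norm_num))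
    fun x (hx : 1 ≤ ‖x‖) => ?_
  have h0 : 0 < ‖x‖ := by linarith
  rw [norm_smul, norm_pow, norm_norm, ← div_eq_mul_inv, div_le_iff₀ (by positivity), mul_pow,
    mul_comm, ← pow_mul]
  gcongr
  norm_num

end IsL2ExteriorSolution

end

theorem theorem3 (Q : Space3 → Matrix (Fin 4) (Fin 4) ℂ) (ψ : Space3 → Spinor)
    (hψ : IsL2ExteriorSolution 1 Q ψ) :
    ∃ φ : Space3 → Spinor,
      (∀ x ∈ ballCompl 1, ψ x = (‖x‖ ^ 2)⁻¹ • φ x) ∧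
      ∀ k : ℝ, 1 ≤ k → k < 10 / 3 →
        (∀ R : ℝ, 1 < R →
          IntegrableOn (fun x => ‖φ x‖ ^ k * (‖x‖ ^ 6)⁻¹) (ballCompl R)) ∧
        ((k ≤ 2 ∨ ∃ r : ℝ, 0 < r ∧ r < 1 ∧ IsL2ExteriorSolution r Q ψ) →
          IntegrableOn (fun x => ‖φ x‖ ^ k * (‖x‖ ^ 6)⁻¹) (ballCompl 1)) := by
  refine ⟨fun x => ‖x‖ ^ 2 • ψ x, fun x (hx : 1 ≤ ‖x‖) => ?_, fun k hk1 hk => ⟨fun R hR => ?_, ?_⟩⟩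
  · have h0 : ‖x‖ ^ 2 ≠ 0 := by positivity
    rw [smul_smul, inv_mul_cancel₀ h0, one_smul]
  · exact hψ.integrableOn_of_le_six one_pos hR hR.le (by linarith) (by linarith)
  · rintro (hk2 | ⟨r, hr, hr1, hψr⟩)
    · exact hψ.integrableOn_of_le_two (by linarith) hk2
    -- With r < 1 the unit sphere is interior, so R = 1 is admissible.
    · exact hψr.integrableOn_of_le_six hr hr1 le_rfl (by linarith) (by linarith)
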